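/- Let $E$ be an infinite set and let $G$ be a group of permutations of $E$ (a subgroup of the symmetric group of $E$). For each integer $n\ge 0$ let $[E]^n$ be the set of $n$-element subsets of $E$, and let $A[G]_n$ be the complex vector space of all functions $f:[E]^n\to\mathbb C$ that are $G$-invariant, i.e. $f(\sigma(P))=f(P)$ for all $\sigma\in G$ and $P\in[E]^n$. The orbit algebra of $G$ is the graded commutative $\mathbb C$-algebra $A[G]=\bigoplus_{n\ge 0}A[G]_n$ whose product is the bilinear extension of the rule $$(fg)(Q)=\sum_{P\subseteq Q,\ |P|=m} f(P)\,g(Q\setminus P)\qquad (f\in A[G]_m,\ g\in A[G]_n,\ Q\in[E]^{m+n}).$$ Then $A[G]$ is an integral domain if and only if $G$ has no finite orbit on $E$, that is, if and only if for every $x\in E$ the orbit $\{\sigma(x):\sigma\in G\}$ is infinite. -/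

import Mathlib

open scoped DirectSum

/-- Complex-valued functions on the collection of finite subsets of `E`
(including the empty set), with pointwise addition and scalar multiplication; the
multiplication is the convolution `(f * g) Q = ∑ P ⊆ Q, f P * g (Q \ P)` defined below. -/
def SetFun (E : Type*) : Type _ := Finset E → ℂ

namespace SetFun

variable {E : Type*}

noncomputable instance : AddCommGroup (SetFun E) :=
  inferInstanceAs (AddCommGroup (Finset E → ℂ))

noncomputable instance : Module ℂ (SetFun E) :=
  inferInstanceAs (Module ℂ (Finset E → ℂ))

@[ext] theorem ext {f g : SetFun E} (h : ∀ Q : Finset E, f Q = g Q) : f = g := funext h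

theorem add_apply (f g : SetFun E) (Q : Finset E) : (f + g) Q = f Q + g Q := rfl

theorem zero_apply (Q : Finset E) : (0 : SetFun E) Q = 0 := rfl

theorem smul_apply (c : ℂ) (f : SetFun E) (Q : Finset E) : (c • f) Q = c * f Q := rfl

open Classical in
/-- The convolution `(f * g) Q = ∑ P ⊆ Q, f P * g (Q \ P)`. -/
noncomputable instance : Mul (SetFun E) :=
  ⟨fun f g Q => ∑ P ∈ Q.powerset, f P * g (Q \ P)⟩

open Classical in
/-- The unit: value `1` on the empty set and `0` on every other finite set. -/
noncomputable instance : One (SetFun E) :=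
  ⟨fun Q => if Q = ∅ then 1 else 0⟩

open Classical in
theorem mul_apply (f g : SetFun E) (Q : Finset E) :
    (f * g) Q = ∑ P ∈ Q.powerset, f P * g (Q \ P) := rfl

open Classical in
theorem one_apply (Q : Finset E) : (1 : SetFun E) Q = if Q = ∅ then 1 else 0 := rfl

protected theorem mul_comm (f g : SetFun E) : f * g = g * f := by
  classical
  ext Q
  rw [mul_apply, mul_apply]
  refine Finset.sum_bij' (fun P _ => Q \ P) (fun P _ => Q \ P) ?_ ?_ ?_ ?_ ?_
  · intro P _
    simp
  · intro P _
    simp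
  · intro P hP
    simpa using Finset.mem_powerset.1 hP
  · intro P hP
    simpa using Finset.mem_powerset.1 hP
  · intro P hP
    simp only [Finset.sdiff_sdiff_eq_self (Finset.mem_powerset.1 hP)]
    exact mul_comm _ _

protected theorem one_mul (f : SetFun E) : 1 * f = f := by
  classical
  ext Q
  rw [mul_apply, Finset.sum_eq_single (∅ : Finset E)]
  · simp [one_apply]
  · intro P _ hP
    simp [one_apply, hP]
  · simp

protected theorem mul_assoc (f g h : SetFun E) : f * g * h = f * (g * h) := by
  classical
  ext Q
  simp only [mul_apply, Finset.sum_mul, Finset.mul_sum]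
  rw [Finset.sum_sigma', Finset.sum_sigma']
  refine Finset.sum_bij' (fun x _ => ⟨x.2, x.1 \ x.2⟩) (fun x _ => ⟨x.1 ∪ x.2, x.1⟩) ?_ ?_ ?_ ?_ ?_
  · rintro ⟨R, P⟩ hx
    simp only [Finset.mem_sigma, Finset.mem_powerset] at hx ⊢
    exact ⟨hx.2.trans hx.1, Finset.sdiff_subset_sdiff hx.1 le_rfl⟩
  · rintro ⟨P, S⟩ hx
    simp only [Finset.mem_sigma, Finset.mem_powerset] at hx ⊢
    exact ⟨Finset.union_subset hx.1 (hx.2.trans Finset.sdiff_subset), Finset.subset_union_left⟩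
  · rintro ⟨R, P⟩ hx
    simp only [Finset.mem_sigma, Finset.mem_powerset] at hx
    simp [Finset.union_sdiff_of_subset hx.2]
  · rintro ⟨P, S⟩ hx
    simp only [Finset.mem_sigma, Finset.mem_powerset] at hx
    have hd : Disjoint P S := (Finset.subset_sdiff.1 hx.2).2.symm
    have : (P ∪ S) \ P = S := by
      rw [Finset.union_sdiff_left, Finset.sdiff_eq_self_of_disjoint hd.symm]
    simp [this]
  · rintro ⟨R, P⟩ hx
    simp only [Finset.mem_sigma, Finset.mem_powerset] at hx
    have : (Q \ P) \ (R \ P) = Q \ R := by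
      ext a
      have h1 := @hx.2 a
      simp only [Finset.mem_sdiff]
      tauto
    simp only [this]
    exact mul_assoc _ _ _

protected theorem mul_add (f g h : SetFun E) : f * (g + h) = f * g + f * h := by
  ext Q
  simp only [mul_apply, add_apply, mul_add, Finset.sum_add_distrib]

protected theorem zero_mul (f : SetFun E) : 0 * f = 0 := by
  ext Q
  simp [mul_apply, zero_apply]

noncomputable instance : CommRing (SetFun E) :=
  { (inferInstance : AddCommGroup (SetFun E)) with
    mul_assoc := SetFun.mul_assoc
    one_mul := SetFun.one_mul
    mul_one := fun f => by rw [SetFun.mul_comm, SetFun.one_mul]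
    mul_comm := SetFun.mul_comm
    left_distrib := SetFun.mul_add
    right_distrib := fun f g h => by
      rw [SetFun.mul_comm, SetFun.mul_add, SetFun.mul_comm h f, SetFun.mul_comm h g]
    zero_mul := SetFun.zero_mul
    mul_zero := fun f => by rw [SetFun.mul_comm, SetFun.zero_mul] }

protected theorem smul_mul (c : ℂ) (f g : SetFun E) : c • f * g = c • (f * g) := by
  ext Q
  simp only [mul_apply, smul_apply, Finset.mul_sum, mul_assoc]

noncomputable instance : Algebra ℂ (SetFun E) :=
  Algebra.ofModule SetFun.smul_mul fun c f g => by
    rw [mul_comm, SetFun.smul_mul, mul_comm]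

end SetFun

/-- The homogeneous component `A[G]ₙ`: the `G`-invariant functions from the `n`-element
subsets of `E` to `ℂ`. Such a function is represented by its extension by `0` to all
finite subsets of `E`. -/
def orbitComponent {E : Type*} (G : Subgroup (Equiv.Perm E)) (n : ℕ) :
    Submodule ℂ (SetFun E) where
  carrier := {f | (∀ P : Finset E, P.card ≠ n → f P = 0) ∧
    ∀ σ ∈ G, ∀ P : Finset E, f (P.map σ.toEmbedding) = f P}
  add_mem' := by
    rintro f g ⟨hf, hf'⟩ ⟨hg, hg'⟩
    refine ⟨fun P hP => ?_, fun σ hσ P => ?_⟩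
    · rw [SetFun.add_apply, hf P hP, hg P hP, add_zero]
    · rw [SetFun.add_apply, SetFun.add_apply, hf' σ hσ, hg' σ hσ]
  zero_mem' := ⟨fun _ _ => rfl, fun _ _ _ => rfl⟩
  smul_mem' := by
    rintro c f ⟨hf, hf'⟩
    refine ⟨fun P hP => ?_, fun σ hσ P => ?_⟩
    · rw [SetFun.smul_apply, hf P hP, mul_zero]
    · rw [SetFun.smul_apply, SetFun.smul_apply, hf' σ hσ]

open Classical in
/-- On homogeneous components, the convolution is the product
`(f g) Q = ∑ f P * g (Q \ P)` over the `m`-element subsets `P` of `Q`. -/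
theorem orbitComponent_mul_apply {E : Type*} (G : Subgroup (Equiv.Perm E)) {m : ℕ}
    {f : SetFun E} (hf : f ∈ orbitComponent G m) (g : SetFun E) (Q : Finset E) :
    (f * g) Q = ∑ P ∈ Q.powersetCard m, f P * g (Q \ P) := by
  rw [SetFun.mul_apply]
  symm
  refine Finset.sum_subset (fun P hP => ?_) (fun P hP hP' => ?_)
  · exact Finset.mem_powerset.2 (Finset.mem_powersetCard.1 hP).1
  · rw [hf.1 P fun h => hP' (Finset.mem_powersetCard.2 ⟨Finset.mem_powerset.1 hP, h⟩), zero_mul]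

/-- The components contain `1` in degree `0`, and `A[G]ₘ A[G]ₙ ⊆ A[G]ₘ₊ₙ`. -/
instance orbitComponent.gradedMonoid {E : Type*} (G : Subgroup (Equiv.Perm E)) :
    SetLike.GradedMonoid (orbitComponent G) where
  one_mem := by
    classical
    refine ⟨fun P hP => ?_, fun σ _ P => ?_⟩
    · rw [SetFun.one_apply, if_neg]
      rintro rfl
      simp at hP
    · simp [SetFun.one_apply]
  mul_mem := by
    classical
    rintro m n f g ⟨hf, hf'⟩ ⟨hg, hg'⟩
    refine ⟨fun Q hQ => ?_, fun σ hσ Q => ?_⟩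
    · rw [SetFun.mul_apply]
      refine Finset.sum_eq_zero fun P hP => ?_
      by_cases h : P.card = m
      · rw [hg (Q \ P), mul_zero]
        have := Finset.card_sdiff_add_card_eq_card (Finset.mem_powerset.1 hP)
        omega
      · rw [hf P h, zero_mul]
    · rw [SetFun.mul_apply, SetFun.mul_apply]
      symm
      refine Finset.sum_bij (fun P _ => P.map σ.toEmbedding) ?_ ?_ ?_ ?_
      · intro P hP
        simpa using hP
      · intro P _ P' _ h
        exact Finset.map_injective _ h
      · intro R hR
        obtain ⟨P, hP, rfl⟩ := Finset.subset_map_iff.1 (Finset.mem_powerset.1 hR)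
        exact ⟨P, Finset.mem_powerset.2 hP, rfl⟩
      · intro P _
        rw [hf' σ hσ, show Q.map σ.toEmbedding \ P.map σ.toEmbedding =
          (Q \ P).map σ.toEmbedding from (Finset.map_sdiff _ _).symm, hg' σ hσ]

/-- The orbit algebra `A[G] = ⨁ₙ A[G]ₙ`, with the graded `ℂ`-algebra structure
(`DirectSum.commRing`) given by the product of homogeneous elements. -/
abbrev OrbitAlgebra {E : Type*} (G : Subgroup (Equiv.Perm E)) : Type _ :=
  ⨁ n : ℕ, orbitComponent G n

/-! Forget the invariance and work in `SetFun E`. It has nilpotents, such as the indicator of a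
single nonempty finite set, but these lie in the ideal `transversalIdeal E`. Modulo this ideal, the
homogeneous functions generate a polynomial ring, which is a domain.

To see this, lift bases of the spaces of indecomposables, degree by degree. The lifts generate by
induction on the degree. They are independent because each has a derivation acting on it and on the
other generators of no larger degree like a partial derivative (`exists_polynomial_generators`).
These derivations come from links: if the linear form `M` kills the ideal and the decomposables of
its degree, then `f ↦ (X ↦ M (link X f))` satisfies the Leibniz rule, since links do so modulo the
ideal (`link_mul_sub_mem`).

If `G` has no finite orbit, Neumann's lemma on coverings by cosets moves any finite set off any
other (`exists_map_disjoint`). A nonzero invariant function then has no finite transversal, so the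
orbit algebra embeds in the polynomial ring. Conversely, the indicator of a finite orbit, as a point
of `[E]^n`, is invariant and has square zero. -/

/-! ### Derivations and polynomial generators modulo an ideal -/

section PolynomialGenerators

universe u w

variable {K : Type u} {R : Type w} [Field K] [CommRing R] [Algebra K R]

/-- A derivation which acts on the generators `v i`, `i ∈ s`, like `∂/∂Xⱼ` acts so on all
polynomials in these generators. -/
theorem Derivation.map_aeval_eq_aeval_pderiv {ι : Type*} {v : ι → R} (D : Derivation K R R)
    {j : ι} {s : Set ι} (hj : D (v j) = 1) (hs : ∀ i ∈ s, i ≠ j → D (v i) = 0)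
    {p : MvPolynomial ι K} (hp : p ∈ MvPolynomial.supported K s) :
    D (MvPolynomial.aeval v p) = MvPolynomial.aeval v (MvPolynomial.pderiv j p) := by
  rw [MvPolynomial.supported] at hp
  induction hp using Algebra.adjoin_induction with
  | mem x hx =>
    obtain ⟨i, hi, rfl⟩ := hx
    rw [MvPolynomial.aeval_X]
    by_cases h : i = j
    · subst h; simp [hj]
    · rw [hs i hi h, MvPolynomial.pderiv_X_of_ne h, map_zero]
  | algebraMap r => simp
  | add x y _ _ hx hy => simp only [map_add, hx, hy]
  | mul x y _ _ hx hy => simp [hx, hy, Derivation.leibniz]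

/-- In characteristic zero, `∂p/∂Xⱼ ≠ 0` if `Xⱼ` occurs in `p`. -/
theorem MvPolynomial.pderiv_ne_zero_of_mem_vars [CharZero K] {ι : Type*} {p : MvPolynomial ι K}
    {j : ι} (hj : j ∈ p.vars) : MvPolynomial.pderiv j p ≠ 0 := by
  classical
  obtain ⟨d, hd, hjd⟩ := (MvPolynomial.mem_vars_iff_mem_support j).1 hj
  intro h
  have hd1 : d - Finsupp.single j 1 + Finsupp.single j 1 = d := by
    refine tsub_add_cancel_of_le (Finsupp.single_le_iff.2 ?_)
    exact Nat.one_le_iff_ne_zero.2 (Finsupp.mem_support_iff.1 hjd)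
  have := MvPolynomial.coeff_pderiv (i := j) p (d - Finsupp.single j 1)
  rw [h, hd1, MvPolynomial.coeff_zero] at this
  rcases mul_eq_zero.1 this.symm with h0 | h0
  · exact MvPolynomial.mem_support_iff.1 hd h0
  · exact Nat.cast_add_one_ne_zero _ h0

theorem MvPolynomial.totalDegree_pderiv_lt {ι : Type*} {p : MvPolynomial ι K}
    {j : ι} (h : MvPolynomial.pderiv j p ≠ 0) :
    (MvPolynomial.pderiv j p).totalDegree < p.totalDegree := by
  classical
  obtain ⟨d, hd, hd'⟩ : ∃ d ∈ (MvPolynomial.pderiv j p).support,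
      (MvPolynomial.pderiv j p).totalDegree = d.sum fun _ e => e := by
    rw [MvPolynomial.totalDegree]
    exact Finset.exists_mem_eq_sup _ (MvPolynomial.support_nonempty.2 h) _
  rw [hd']
  have hc := MvPolynomial.mem_support_iff.1 hd
  rw [MvPolynomial.coeff_pderiv] at hc
  have := MvPolynomial.le_totalDegree (MvPolynomial.mem_support_iff.2 (left_ne_zero_of_mul hc))
  rw [Finsupp.sum_add_index' (fun _ => rfl) (fun _ _ _ => rfl)] at this
  simp at this
  omega

/-- If for each `j` some derivation stabilizing `I` acts like `∂/∂Xⱼ` on the generators `v i` of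
degree at most that of `v j`, then the `v i` are algebraically independent modulo `I`. -/
theorem MvPolynomial.eq_zero_of_aeval_mem [CharZero K] {I : Ideal R} (hI : I ≠ ⊤) {ι : Type*}
    (v : ι → R) (deg : ι → ℕ)
    (key : ∀ j : ι, ∃ D : Derivation K R R, (∀ x ∈ I, D x ∈ I) ∧ D (v j) = 1 ∧
      ∀ i : ι, deg i ≤ deg j → i ≠ j → D (v i) = 0) :
    ∀ p : MvPolynomial ι K, MvPolynomial.aeval v p ∈ I → p = 0 := by
  intro p
  induction hn : p.totalDegree using Nat.strong_induction_on generalizing p with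
  | _ n ih =>
  intro hp
  by_contra hp0
  rcases p.vars.eq_empty_or_nonempty with h0 | h0
  · rw [MvPolynomial.vars_eq_empty_iff_eq_C] at h0
    obtain ⟨c, hc⟩ : ∃ c, p = MvPolynomial.C c := ⟨_, h0⟩
    have hc0 : c ≠ 0 := by
      rintro rfl
      exact hp0 (by rw [hc, MvPolynomial.C_0])
    rw [hc, MvPolynomial.aeval_C] at hp
    exact hI (Ideal.eq_top_of_isUnit_mem _ hp (hc0.isUnit.map (algebraMap K R)))
  -- As `j` has maximal degree among the variables of `p`, its derivation kills all the other
  -- generators in `p`. Hence `∂p/∂Xⱼ` is a nonzero relation of smaller total degree.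
  · obtain ⟨j, hj, hmax⟩ := Finset.exists_max_image p.vars deg h0
    obtain ⟨D, hDI, hDj, hDi⟩ := key j
    have h1 := hDI _ hp
    have hs : ∀ i ∈ (p.vars : Set ι), i ≠ j → D (v i) = 0 := fun i hi hij =>
      hDi i (hmax i (Finset.mem_coe.1 hi)) hij
    have hp' : p ∈ MvPolynomial.supported K (p.vars : Set ι) := MvPolynomial.mem_supported.2 le_rfl
    rw [D.map_aeval_eq_aeval_pderiv hDj hs hp'] at h1
    have h2 := MvPolynomial.pderiv_ne_zero_of_mem_vars hj
    have hlt := MvPolynomial.totalDegree_pderiv_lt h2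
    rw [hn] at hlt
    exact h2 (ih _ hlt _ rfl h1)

/-- The elements of degree `l` that are decomposable modulo the ideal `I`. -/
def decomposableModulo (I : Ideal R) (A : ℕ → Submodule K R) (l : ℕ) : Submodule K R :=
  I.restrictScalars K ⊔
    Submodule.span K {z | ∃ i j, 0 < i ∧ 0 < j ∧ i + j = l ∧ ∃ a ∈ A i, ∃ b ∈ A j, a * b = z}

/-- Criterion for the algebra generated by the `A n` to be a polynomial algebra modulo `I`: each
linear form on `A l` vanishing on the decomposable elements is induced by a derivation. -/
theorem exists_polynomial_generators [CharZero K] (I : Ideal R) (hI : I ≠ ⊤)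
    (A : ℕ → Submodule K R) (hA : ∀ x ∈ A 0, ∃ c : K, algebraMap K R c = x)
    (hD : ∀ l, 0 < l → ∀ M : R →ₗ[K] K, (∀ x ∈ decomposableModulo I A l, M x = 0) →
      ∃ D : Derivation K R R, (∀ x ∈ I, D x ∈ I) ∧ (∀ k < l, ∀ x ∈ A k, D x = 0) ∧
        ∀ x ∈ A l, D x = algebraMap K R (M x)) :
    ∃ (ι : Type w) (v : ι → R), (∀ p : MvPolynomial ι K, MvPolynomial.aeval v p ∈ I → p = 0) ∧
      ∀ n, ∀ x ∈ A n, ∃ p : MvPolynomial ι K, x - MvPolynomial.aeval v p ∈ I := by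
  classical
  let J := decomposableModulo I A
  let V : ∀ l, Submodule K (R ⧸ J l) := fun l => (A l).map (J l).mkQ
  let b := fun l => Module.Basis.ofVectorSpace K (V l)
  have hv : ∀ l, ∀ i, ∃ x ∈ A l, (J l).mkQ x = b l i := fun l i => (b l i).2
  choose w hwA hw using hv
  -- The shift by one leaves out degree `0`, which consists of scalars.
  let ι := Σ l : ℕ, Module.Basis.ofVectorSpaceIndex K (V (l + 1))
  let v : ι → R := fun i => w (i.1 + 1) i.2
  refine ⟨ι, v, ?_, ?_⟩
  · have key : ∀ j : ι, ∃ D : Derivation K R R, (∀ x ∈ I, D x ∈ I) ∧ D (v j) = 1 ∧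
        ∀ i : ι, i.1 ≤ j.1 → i ≠ j → D (v i) = 0 := by
      rintro ⟨l, j⟩
      -- Pulled back to `R`, the extended coordinate form vanishes on the decomposables, so `hD`
      -- applies to it.
      obtain ⟨g, hg⟩ := LinearMap.exists_extend ((b (l + 1)).coord j)
      have hgw : ∀ i, g ((J (l + 1)).mkQ (w (l + 1) i)) = if i = j then 1 else 0 := by
        intro i
        rw [hw]
        have := LinearMap.congr_fun hg (b (l + 1) i)
        simp only [LinearMap.comp_apply, Submodule.subtype_apply] at this
        rw [this, Module.Basis.coord_apply, Module.Basis.repr_self, Finsupp.single_apply]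
      obtain ⟨D, hDI, hDlt, hDl⟩ := hD (l + 1) l.succ_pos (g ∘ₗ (J (l + 1)).mkQ) (by
        intro x hx
        rw [LinearMap.comp_apply, Submodule.mkQ_apply, (Submodule.Quotient.mk_eq_zero _).2 hx,
          map_zero])
      refine ⟨D, hDI, ?_, ?_⟩
      · rw [hDl _ (hwA _ _), LinearMap.comp_apply, hgw, if_pos rfl, map_one]
      · rintro ⟨k, i⟩ hk hij
        rcases Nat.lt_or_eq_of_le hk with hk | hk
        · exact hDlt _ (Nat.succ_lt_succ hk) _ (hwA _ _)
        · obtain rfl : k = l := hk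
          rw [hDl _ (hwA _ _), LinearMap.comp_apply, hgw, if_neg, map_zero]
          rintro rfl
          exact hij rfl
    exact MvPolynomial.eq_zero_of_aeval_mem hI v Sigma.fst key
  · let S : Submodule K R :=
      I.restrictScalars K ⊔ LinearMap.range (MvPolynomial.aeval (R := K) v).toLinearMap
    have hS : ∀ x, x ∈ S ↔ ∃ p : MvPolynomial ι K, x - MvPolynomial.aeval v p ∈ I := by
      intro x
      simp only [S, Submodule.mem_sup, LinearMap.mem_range, AlgHom.toLinearMap_apply]
      constructor
      · rintro ⟨y, hy, _, ⟨p, rfl⟩, rfl⟩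
        exact ⟨p, by simpa using hy⟩
      · rintro ⟨p, hp⟩
        exact ⟨_, hp, _, ⟨p, rfl⟩, sub_add_cancel _ _⟩
    intro n
    induction n using Nat.strong_induction_on with
    | _ n ih =>
    intro x hx
    rcases n with _ | n
    · obtain ⟨c, rfl⟩ := hA x hx
      exact ⟨MvPolynomial.C c, by simp⟩
    -- Both factors of a decomposable element have smaller degree, so induction covers them.
    have hJS : J (n + 1) ≤ S := by
      refine sup_le le_sup_left (Submodule.span_le.2 ?_)
      rintro _ ⟨i, j, hi, hj, hij, y, hy, z, hz, rfl⟩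
      obtain ⟨p, hp⟩ := ih i (by omega) y hy
      obtain ⟨q, hq⟩ := ih j (by omega) z hz
      refine (hS _).2 ⟨p * q, ?_⟩
      rw [map_mul, show y * z - MvPolynomial.aeval v p * MvPolynomial.aeval v q =
        z * (y - MvPolynomial.aeval v p) + MvPolynomial.aeval v p * (z - MvPolynomial.aeval v q)
        by ring]
      exact I.add_mem (I.mul_mem_left _ hp) (I.mul_mem_left _ hq)
    have hVS : V (n + 1) ≤ S.map (J (n + 1)).mkQ := by
      have h1 : Submodule.span K (Set.range fun i => ((b (n + 1) i : V (n + 1)) : R ⧸ J (n + 1)))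
          = V (n + 1) := by
        have := congrArg (Submodule.map (V (n + 1)).subtype) (b (n + 1)).span_eq
        rw [Submodule.map_span, ← Set.range_comp, Submodule.map_top, Submodule.range_subtype] at this
        exact this
      rw [← h1, Submodule.span_le]
      rintro _ ⟨i, rfl⟩
      refine ⟨w (n + 1) i, (hS _).2 ⟨MvPolynomial.X ⟨n, i⟩, ?_⟩, hw _ _⟩
      rw [MvPolynomial.aeval_X]
      simp [v]
    obtain ⟨y, hy, hyx⟩ := hVS (Submodule.mem_map_of_mem hx)
    rw [← hS, ← sub_add_cancel x y]
    refine S.add_mem (hJS ?_) hy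
    rw [← Submodule.ker_mkQ (J (n + 1)), LinearMap.mem_ker, map_sub, hyx, sub_self]

end PolynomialGenerators

/-! ### Functions with a finite transversal and homogeneous components -/

namespace SetFun

variable {E : Type*}

theorem sum_apply {ι : Type*} (s : Finset ι) (f : ι → SetFun E) (Q : Finset E) :
    (∑ i ∈ s, f i) Q = ∑ i ∈ s, f i Q := by
  classical
  induction s using Finset.induction_on with
  | empty => rfl
  | insert a s ha ih => rw [Finset.sum_insert ha, Finset.sum_insert ha, add_apply, ih]

theorem mem_orbitComponent_bot {n : ℕ} {f : SetFun E} :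
    f ∈ orbitComponent (⊥ : Subgroup (Equiv.Perm E)) n ↔ ∀ P : Finset E, P.card ≠ n → f P = 0 := by
  refine ⟨fun h => h.1, fun h => ⟨h, fun σ hσ P => ?_⟩⟩
  rw [Subgroup.mem_bot.1 hσ]
  change f (P.map (Function.Embedding.refl E)) = f P
  rw [Finset.map_refl]

variable (E) in
/-- The ideal of functions whose support has a finite transversal. -/
def transversalIdeal : Ideal (SetFun E) where
  carrier := {f | ∃ T : Finset E, ∀ P, Disjoint P T → f P = 0}
  add_mem' := by
    classical
    rintro f g ⟨T, hT⟩ ⟨U, hU⟩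
    refine ⟨T ∪ U, fun P hP => ?_⟩
    rw [Finset.disjoint_union_right] at hP
    rw [add_apply, hT P hP.1, hU P hP.2, add_zero]
  zero_mem' := ⟨∅, fun _ _ => rfl⟩
  smul_mem' := by
    classical
    rintro f g ⟨T, hT⟩
    refine ⟨T, fun P hP => ?_⟩
    rw [smul_eq_mul, mul_apply]
    refine Finset.sum_eq_zero fun R _ => ?_
    rw [hT _ (hP.mono_left Finset.sdiff_subset), mul_zero]

theorem transversalIdeal_ne_top : transversalIdeal E ≠ ⊤ := by
  classical
  rw [Ideal.ne_top_iff_one]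
  rintro ⟨T, hT⟩
  have := hT ∅ (Finset.disjoint_empty_left T)
  rw [one_apply, if_pos rfl] at this
  exact one_ne_zero this

/-- The homogeneous component of degree `l`. -/
noncomputable def proj (l : ℕ) : SetFun E →ₗ[ℂ] SetFun E where
  toFun f := fun P => if P.card = l then f P else 0
  map_add' _ _ := funext fun _ => ite_add_zero
  map_smul' _ _ := funext fun _ => (mul_ite_zero ..).symm

theorem proj_apply (l : ℕ) (f : SetFun E) (P : Finset E) :
    proj l f P = if P.card = l then f P else 0 := rfl

theorem proj_mem (l : ℕ) (f : SetFun E) :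
    proj l f ∈ orbitComponent (⊥ : Subgroup (Equiv.Perm E)) l :=
  mem_orbitComponent_bot.2 fun _ hP => if_neg hP

theorem proj_mem_transversalIdeal (l : ℕ) {f : SetFun E} (hf : f ∈ transversalIdeal E) :
    proj l f ∈ transversalIdeal E := by
  obtain ⟨T, hT⟩ := hf
  exact ⟨T, fun P hP => by rw [proj_apply, hT P hP, ite_self]⟩

theorem proj_eq_self {l : ℕ} {f : SetFun E}
    (hf : f ∈ orbitComponent (⊥ : Subgroup (Equiv.Perm E)) l) : proj l f = f := by
  ext P
  rw [proj_apply]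
  split_ifs with h
  · rfl
  · exact (hf.1 P h).symm

theorem proj_zero (f : SetFun E) : proj 0 f = f ∅ • 1 := by
  classical
  ext P
  rw [proj_apply, smul_apply, one_apply]
  by_cases h : P = ∅
  · simp [h]
  · simp [h]

theorem proj_mul (l : ℕ) (f g : SetFun E) :
    proj l (f * g) = ∑ x ∈ Finset.HasAntidiagonal.antidiagonal l, proj x.1 f * proj x.2 g := by
  classical
  ext Q
  rw [sum_apply, proj_apply, mul_apply]
  simp only [mul_apply, proj_apply]
  rw [Finset.sum_comm]
  trans ∑ P ∈ Q.powerset, if Q.card = l then f P * g (Q \ P) else 0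
  · by_cases h : Q.card = l
    · simp only [if_pos h]
    · simp only [if_neg h, Finset.sum_const_zero]
  -- Only the pair `(|P|, |Q \ P|)` can contribute, and it lies on the antidiagonal exactly when
  -- `|Q| = l`.
  refine Finset.sum_congr rfl fun P hP => ?_
  have hc := Finset.card_sdiff_add_card_eq_card (Finset.mem_powerset.1 hP)
  simp only [ite_zero_mul_ite_zero]
  rw [← Finset.sum_filter]
  split_ifs with h
  · rw [show (Finset.HasAntidiagonal.antidiagonal l).filter
        (fun x => P.card = x.1 ∧ (Q \ P).card = x.2) =
      {(P.card, (Q \ P).card)} from ?_, Finset.sum_singleton]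
    ext ⟨i, j⟩
    simp only [Finset.mem_filter, Finset.HasAntidiagonal.mem_antidiagonal, Finset.mem_singleton,
      Prod.mk.injEq]
    omega
  · rw [Finset.filter_eq_empty_iff.2 ?_, Finset.sum_empty]
    rintro ⟨i, j⟩ hij
    simp only [Finset.HasAntidiagonal.mem_antidiagonal] at hij ⊢
    omega

/-! ### Links and the derivations they induce -/

section Link

open scoped Classical

/-- The link of a finite set `X` in `f`: the function `Y ↦ f (X ∪ Y)` on the sets `Y` disjoint
from `X`. -/
noncomputable def link (X : Finset E) : SetFun E →ₗ[ℂ] SetFun E where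
  toFun f := fun Y => if Disjoint X Y then f (X ∪ Y) else 0
  map_add' _ _ := funext fun _ => ite_add_zero
  map_smul' _ _ := funext fun _ => (mul_ite_zero ..).symm

theorem link_apply (X : Finset E) (f : SetFun E) (Y : Finset E) :
    link X f Y = if Disjoint X Y then f (X ∪ Y) else 0 := rfl

theorem link_apply_empty (X : Finset E) (f : SetFun E) : link X f ∅ = f X := by
  simp [link_apply]

theorem link_empty (f : SetFun E) : link ∅ f = f := by
  ext Y
  simp [link_apply]

/-- For `Y` disjoint from `X`, a subset of `X ∪ Y` is a subset of `X` together with one of `Y`, so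
the two sides agree at `Y`. Thus `X` itself is a transversal of the difference. -/
theorem link_mul_sub_mem (X : Finset E) (f g : SetFun E) :
    link X (f * g) - ∑ S ∈ X.powerset, link S f * link (X \ S) g ∈ transversalIdeal E := by
  refine ⟨X, fun Y hY => ?_⟩
  rw [sub_eq_add_neg, add_apply, show (-∑ S ∈ X.powerset, link S f * link (X \ S) g) Y =
    -((∑ S ∈ X.powerset, link S f * link (X \ S) g) Y) from rfl, ← sub_eq_add_neg, sub_eq_zero,
    link_apply, if_pos hY.symm, sum_apply]
  simp only [mul_apply, link_apply]
  rw [← Finset.sum_product']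
  symm
  refine Finset.sum_bij' (fun x _ => x.1 ∪ x.2) (fun P _ => (P ∩ X, P ∩ Y)) ?_ ?_ ?_ ?_ ?_
  · rintro ⟨S, T⟩ h
    simp only [Finset.mem_product, Finset.mem_powerset] at h ⊢
    exact Finset.union_subset_union h.1 h.2
  · intro P _
    simp
  · rintro ⟨S, T⟩ h
    simp only [Finset.mem_product, Finset.mem_powerset] at h
    have h1 := Finset.disjoint_left.1 hY
    ext x
    · have := @h.1 x; have := @h.2 x; have := @h1 x
      simp only [Finset.mem_inter, Finset.mem_union]; tauto
    · have := @h.1 x; have := @h.2 x; have := @h1 x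
      simp only [Finset.mem_inter, Finset.mem_union]; tauto
  · intro P h
    rw [Finset.mem_powerset] at h
    rw [← Finset.inter_union_distrib_left, Finset.inter_eq_left.2 h]
  · rintro ⟨S, T⟩ h
    simp only [Finset.mem_product, Finset.mem_powerset] at h
    have h1 := Finset.disjoint_left.1 hY
    simp only
    rw [if_pos (hY.symm.mono h.1 h.2), if_pos (hY.symm.mono Finset.sdiff_subset Finset.sdiff_subset)]
    congr 2
    ext x
    have := @h.1 x; have := @h.2 x; have := @h1 x
    simp only [Finset.mem_sdiff, Finset.mem_union]; tauto

/-- A linear form `M` on `SetFun E` which vanishes on `transversalIdeal E` and is a derivation at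
the augmentation `f ↦ f ∅` induces the derivation `f ↦ (X ↦ M (link X f))`. -/
noncomputable def linkDerivation (M : SetFun E →ₗ[ℂ] ℂ) (hI : ∀ f ∈ transversalIdeal E, M f = 0)
    (hM : ∀ f g, M (f * g) = f ∅ * M g + M f * g ∅) : Derivation ℂ (SetFun E) (SetFun E) :=
  Derivation.mk'
    { toFun := fun f X => M (link X f)
      map_add' := fun f g => funext fun X =>
        (congrArg M (map_add (link X) f g)).trans (map_add M _ _)
      map_smul' := fun c f => funext fun X =>
        (congrArg M (map_smul (link X) c f)).trans (map_smul M _ _) }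
    (by
      intro f g
      ext X
      have h := hI _ (link_mul_sub_mem X f g)
      rw [map_sub, sub_eq_zero] at h
      rw [smul_eq_mul, smul_eq_mul, mul_comm g, add_apply, mul_apply, mul_apply,
        ← Finset.sum_add_distrib]
      refine h.trans ?_
      rw [map_sum]
      refine Finset.sum_congr (by congr!) fun S _ => ?_
      -- The `S`-term becomes `f S * M (link (X \ S) g) + M (link S f) * g (X \ S)`, the matching
      -- terms of two convolutions.
      rw [hM, link_apply_empty, link_apply_empty]
      rfl)

theorem linkDerivation_apply (M : SetFun E →ₗ[ℂ] ℂ) (hI : ∀ f ∈ transversalIdeal E, M f = 0)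
    (hM : ∀ f g, M (f * g) = f ∅ * M g + M f * g ∅) (f : SetFun E) (X : Finset E) :
    linkDerivation M hI hM f X = M (link X f) := rfl

end Link

/-- A linear form on the component of degree `l > 0` which vanishes on decomposable elements is
induced by a derivation. -/
theorem exists_derivation {l : ℕ} (hl : 0 < l) (M : SetFun E →ₗ[ℂ] ℂ)
    (hM : ∀ x ∈ decomposableModulo (transversalIdeal E) (orbitComponent ⊥) l, M x = 0) :
    ∃ D : Derivation ℂ (SetFun E) (SetFun E), (∀ x ∈ transversalIdeal E, D x ∈ transversalIdeal E) ∧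
      (∀ k < l, ∀ x ∈ orbitComponent ⊥ k, D x = 0) ∧
      ∀ x ∈ orbitComponent ⊥ l, D x = algebraMap ℂ (SetFun E) (M x) := by
  classical
  have hMI : ∀ f ∈ transversalIdeal E, M f = 0 := fun f hf =>
    hM f (Submodule.mem_sup_left hf)
  have hI : ∀ f ∈ transversalIdeal E, (M ∘ₗ proj l) f = 0 := fun f hf =>
    hMI _ (proj_mem_transversalIdeal l hf)
  have hmul : ∀ f g, (M ∘ₗ proj l) (f * g) = f ∅ * (M ∘ₗ proj l) g + (M ∘ₗ proj l) f * g ∅ := by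
    intro f g
    rw [LinearMap.comp_apply, proj_mul, map_sum,
      Finset.sum_eq_add (0, l) (l, 0) (by simp [hl.ne]) ?_ (by simp) (by simp)]
    · rw [proj_zero, proj_zero, smul_mul_assoc, one_mul, mul_smul_comm, mul_one, map_smul, map_smul,
        smul_eq_mul, smul_eq_mul, mul_comm (g ∅)]
      rfl
    -- Away from the two ends of the antidiagonal both degrees are positive, so the product is
    -- decomposable.
    · rintro ⟨i, j⟩ hij ⟨h1, h2⟩
      rw [Finset.HasAntidiagonal.mem_antidiagonal] at hij
      refine hM _ (Submodule.mem_sup_right (Submodule.subset_span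
        ⟨i, j, ?_, ?_, hij, _, proj_mem i f, _, proj_mem j g, rfl⟩))
      · rcases Nat.eq_zero_or_pos i with rfl | h
        · exact absurd (by simpa using hij) (fun h : j = l => h1 (by rw [h]))
        · exact h
      · rcases Nat.eq_zero_or_pos j with rfl | h
        · exact absurd (by simpa using hij) (fun h : i = l => h2 (by rw [h]))
        · exact h
  refine ⟨linkDerivation _ hI hmul, ?_, ?_, ?_⟩
  · rintro f ⟨T, hT⟩
    refine ⟨T, fun X hX => hI _ ⟨T, fun Y hY => ?_⟩⟩
    rw [link_apply, hT _ (Finset.disjoint_union_left.2 ⟨hX, hY⟩), ite_self]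
  -- A link never raises the degree, so no component of degree `l` arises; in degree `l` itself,
  -- below, only `X = ∅` leaves one.
  · intro k hk f hf
    ext X
    rw [linkDerivation_apply, LinearMap.comp_apply, show proj l (link X f) = 0 from ?_, map_zero,
      zero_apply]
    ext Y
    rw [proj_apply, link_apply, zero_apply]
    split_ifs with h1 h2
    · refine hf.1 _ ?_
      rw [Finset.card_union_of_disjoint h2]
      omega
    · rfl
    · rfl
  · intro f hf
    ext X
    rw [linkDerivation_apply, LinearMap.comp_apply, Algebra.algebraMap_eq_smul_one, smul_apply,
      one_apply]
    split_ifs with h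
    · rw [h, link_empty, proj_eq_self hf, mul_one]
    · rw [show proj l (link X f) = 0 from ?_, map_zero, mul_zero]
      ext Y
      rw [proj_apply, link_apply, zero_apply]
      split_ifs with h1 h2
      · refine hf.1 _ ?_
        rw [Finset.card_union_of_disjoint h2]
        have := Finset.card_pos.2 (Finset.nonempty_iff_ne_empty.2 h)
        omega
      · rfl
      · rfl

end SetFun

/-! ### Groups without finite orbits: embedding into a polynomial ring -/

/-- If `G` has no finite orbit, then every finite set can be moved off any other finite set. -/
theorem exists_map_disjoint {E : Type*} {G : Subgroup (Equiv.Perm E)}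
    (hG : ∀ x : E, ¬ (MulAction.orbit G x).Finite) (P T : Finset E) :
    ∃ σ ∈ G, Disjoint (P.map σ.toEmbedding) T := by
  classical
  -- Otherwise every `σ` sends some `p ∈ P` to some `t ∈ T`. For fixed `(p, t)` such `σ` form a left
  -- coset of the stabilizer of `p` or nothing, so finitely many cosets cover `G` and some
  -- stabilizer has finite index.
  by_contra! h
  let s : Finset (E × E) := (P ×ˢ T).filter fun x => ∃ σ : G, σ • x.1 = x.2
  let g : E × E → G := fun x => if hx : ∃ σ : G, σ • x.1 = x.2 then hx.choose else 1
  have hg : ∀ x : E × E, (∃ σ : G, σ • x.1 = x.2) → g x • x.1 = x.2 := fun x hx => by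
    simp only [g, dif_pos hx]
    exact hx.choose_spec
  obtain ⟨x, -, hx⟩ := Subgroup.exists_finiteIndex_of_leftCoset_cover (s := s) (g := g)
    (H := fun x => MulAction.stabilizer G x.1) (by
      refine Set.eq_univ_of_forall fun σ => ?_
      obtain ⟨t, ht, htT⟩ := Finset.not_disjoint_iff.1 (h σ σ.2)
      obtain ⟨p, hp, rfl⟩ := Finset.mem_map.1 ht
      have hσ : ∃ τ : G, τ • p = σ.1 p := ⟨σ, rfl⟩
      refine Set.mem_iUnion₂.2 ⟨(p, σ.1 p),
        Finset.mem_filter.2 ⟨Finset.mem_product.2 ⟨hp, htT⟩, hσ⟩, ?_⟩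
      rw [mem_leftCoset_iff, SetLike.mem_coe, MulAction.mem_stabilizer_iff, mul_smul,
        inv_smul_eq_iff, hg _ hσ]
      rfl)
  refine hG x.1 ?_
  have : Finite (G ⧸ MulAction.stabilizer G x.1) := Subgroup.finiteIndex_iff_finite_quotient.1 hx
  have : Finite (MulAction.orbit G x.1) :=
    Finite.of_equiv _ (MulAction.orbitEquivQuotientStabilizer G x.1).symm
  exact Set.toFinite _

theorem orbitComponent_le_bot {E : Type*} (G : Subgroup (Equiv.Perm E)) (n : ℕ) :
    orbitComponent G n ≤ orbitComponent ⊥ n :=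
  fun _ hf => SetFun.mem_orbitComponent_bot.2 hf.1

theorem SetFun.proj_coeAlgHom {E : Type*} {G : Subgroup (Equiv.Perm E)} (n : ℕ)
    (F : OrbitAlgebra G) : proj n (DirectSum.coeAlgHom (orbitComponent G) F) = F n := by
  classical
  induction F using DirectSum.induction_on with
  | zero => simp
  | of i x =>
    rw [DirectSum.coeAlgHom_of]
    by_cases h : i = n
    · subst h
      rw [DirectSum.of_eq_same, proj_eq_self (orbitComponent_le_bot G i x.2)]
    · rw [DirectSum.of_eq_of_ne _ _ _ (Ne.symm h)]
      ext P
      rw [proj_apply]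
      split_ifs with hP
      · exact x.2.1 P (fun h' => h (h'.symm.trans hP))
      · rfl
  | add x y hx hy => rw [map_add, map_add, hx, hy]; rfl

/-- If `G` has no finite orbit, then a nonzero element of the orbit algebra has no finite
transversal. -/
theorem orbitAlgebra_eq_zero_of_mem {E : Type*} {G : Subgroup (Equiv.Perm E)}
    (hG : ∀ x : E, ¬ (MulAction.orbit G x).Finite) {F : OrbitAlgebra G}
    (hF : DirectSum.coeAlgHom (orbitComponent G) F ∈ SetFun.transversalIdeal E) : F = 0 := by
  classical
  refine DFinsupp.ext fun n => Subtype.ext ?_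
  obtain ⟨T, hT⟩ := SetFun.proj_mem_transversalIdeal n hF
  rw [SetFun.proj_coeAlgHom] at hT
  ext P
  obtain ⟨σ, hσ, hd⟩ := exists_map_disjoint hG P T
  rw [← (F n).2.2 σ hσ P, hT _ hd]
  rfl

theorem orbitAlgebra_isDomain {E : Type*} {G : Subgroup (Equiv.Perm E)}
    (hG : ∀ x : E, ¬ (MulAction.orbit G x).Finite) : IsDomain (OrbitAlgebra G) := by
  classical
  obtain ⟨ι, v, hv, hvA⟩ := exists_polynomial_generators (K := ℂ) (SetFun.transversalIdeal E)
    SetFun.transversalIdeal_ne_top (orbitComponent ⊥)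
    (fun x hx => ⟨x ∅, by
      rw [Algebra.algebraMap_eq_smul_one, ← SetFun.proj_zero, SetFun.proj_eq_self hx]⟩)
    fun l hl M hM => SetFun.exists_derivation hl M hM
  let q := Ideal.Quotient.mk (SetFun.transversalIdeal E)
  let φ : OrbitAlgebra G →+* SetFun E ⧸ SetFun.transversalIdeal E :=
    q.comp (DirectSum.coeAlgHom (orbitComponent G)).toRingHom
  let ψ : MvPolynomial ι ℂ →+* SetFun E ⧸ SetFun.transversalIdeal E :=
    q.comp (MvPolynomial.aeval v).toRingHom
  have hφ : Function.Injective φ := (injective_iff_map_eq_zero φ).2 fun F hF =>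
    orbitAlgebra_eq_zero_of_mem hG (Ideal.Quotient.eq_zero_iff_mem.1 hF)
  have hψ : Function.Injective ψ := (injective_iff_map_eq_zero ψ).2 fun p hp =>
    hv p (Ideal.Quotient.eq_zero_iff_mem.1 hp)
  have hφψ : ∀ F, φ F ∈ ψ.range := by
    intro F
    induction F using DirectSum.induction_on with
    | zero => rw [map_zero]; exact zero_mem _
    | of i x =>
      obtain ⟨p, hp⟩ := hvA i x (orbitComponent_le_bot G i x.2)
      refine ⟨p, (Ideal.Quotient.eq.2 ?_).symm⟩
      simpa using hp
    | add x y hx hy => rw [map_add]; exact add_mem hx hy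
  -- The range of `ψ`, not the whole quotient, is the polynomial ring: `SetFun E` also has elements
  -- with infinitely many nonzero components.
  have : IsDomain ψ.range :=
    (RingEquiv.ofBijective ψ.rangeRestrict ⟨fun x y h => hψ (congrArg Subtype.val h),
      ψ.rangeRestrict_surjective⟩).symm.toMulEquiv.isDomain _
  exact Function.Injective.isDomain (φ.codRestrict ψ.range hφψ) fun x y h =>
    hφ (congrArg Subtype.val h)

/-! ### Finite orbits give nilpotent elements -/

open Classical in
/-- The function with value `1` on the finite set `O` and `0` on every other finite set. -/
noncomputable def SetFun.single {E : Type*} (O : Finset E) : SetFun E :=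
  fun P => if P = O then 1 else 0

open Classical in
theorem SetFun.single_apply {E : Type*} (O P : Finset E) :
    single O P = if P = O then 1 else 0 := rfl

/-- A nonempty set is not disjoint from itself, so no `Q` splits into two copies of `O`. -/
theorem SetFun.single_mul_self {E : Type*} {O : Finset E} (hO : O.Nonempty) :
    single O * single O = 0 := by
  classical
  obtain ⟨x, hx⟩ := hO
  ext Q
  rw [mul_apply, zero_apply]
  refine Finset.sum_eq_zero fun P _ => ?_
  rw [single_apply, single_apply]
  by_cases hP : P = O
  · rw [if_pos hP, if_neg, mul_zero]
    intro h
    rw [← h] at hx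
    refine (Finset.mem_sdiff.1 hx).2 ?_
    rwa [hP, ← h]
  · rw [if_neg hP, zero_mul]

theorem single_mem_orbitComponent {E : Type*} {G : Subgroup (Equiv.Perm E)} {O : Finset E}
    (hO : ∀ σ ∈ G, O.map σ.toEmbedding = O) :
    SetFun.single O ∈ orbitComponent G O.card := by
  refine ⟨fun P hP => if_neg ?_, fun σ hσ P => ?_⟩
  · rintro rfl
    exact hP rfl
  · have : P.map σ.toEmbedding = O ↔ P = O := by
      constructor
      · intro h
        exact Finset.map_injective σ.toEmbedding (h.trans (hO σ hσ).symm)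
      · rintro rfl
        exact hO σ hσ
    classical exact if_congr this rfl rfl

theorem not_isDomain_of_finite_orbit {E : Type*} {G : Subgroup (Equiv.Perm E)} {x : E}
    (hx : (MulAction.orbit G x).Finite) : ¬ IsDomain (OrbitAlgebra G) := by
  classical
  intro hdom
  let O := hx.toFinset
  have hO : ∀ σ ∈ G, O.map σ.toEmbedding = O := by
    intro σ hσ
    refine Finset.eq_of_subset_of_card_le (fun y hy => ?_) (Finset.card_map _).ge
    obtain ⟨z, hz, rfl⟩ := Finset.mem_map.1 hy
    rw [Set.Finite.mem_toFinset] at hz ⊢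
    obtain ⟨τ, rfl⟩ := hz
    exact ⟨⟨σ, hσ⟩ * τ, rfl⟩
  let f : orbitComponent G O.card := ⟨SetFun.single O, single_mem_orbitComponent hO⟩
  have hff : SetFun.single O * SetFun.single O = 0 :=
    SetFun.single_mul_self ⟨x, hx.mem_toFinset.2 (MulAction.mem_orbit_self x)⟩
  let F : OrbitAlgebra G := DirectSum.of (fun n => orbitComponent G n) O.card f
  have hFF : F * F = 0 := by
    refine (DirectSum.of_mul_of (A := fun n => orbitComponent G n) f f).trans ?_
    have : GradedMonoid.GMul.mul (A := fun n => orbitComponent G n) f f = 0 := Subtype.ext hff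
    rw [this, map_zero]
  have h1 : f = 0 :=
    DirectSum.of_injective (β := fun n => orbitComponent G n) O.card
      ((mul_self_eq_zero.1 hFF).trans (map_zero _).symm)
  have h2 : SetFun.single O O = 0 := congrFun (congrArg Subtype.val h1) O
  rw [SetFun.single_apply, if_pos rfl] at h2
  exact one_ne_zero h2

theorem mainTheorem3 {E : Type*} [Infinite E] (G : Subgroup (Equiv.Perm E)) :
    IsDomain (OrbitAlgebra G) ↔ ∀ x : E, ¬ (MulAction.orbit G x).Finite :=
  ⟨fun h _ hx => not_isDomain_of_finite_orbit hx h, orbitAlgebra_isDomain⟩
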